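/- Conventions: a partition is a finite non-increasing sequence of positive integers; $|\lambda|$ denotes the sum of its parts, and the empty partition is allowed. The Durfee square of a partition has side $d$, the largest integer such that at least $d$ of the parts are $\ge d$. The successive Durfee squares of a partition are its Durfee square (the first one), then the Durfee square of the partition formed by the parts below the first square, and so on, where the side is $0$ once no parts are left. Let $m$ be an integer and let $k,n$ be positive integers. Let $R_{k,m}(n)$ be the set of pairs of partitions $(\lambda,\delta)$ with $|\lambda|+|\delta|=n$, where $\lambda$ is arbitrary and $\delta$ is the fixed partition with exactly $|m|$ parts $$\delta=\begin{cases}\big((2k+1)(m-1)+(k+1),\,(2k+1)(m-2)+(k+1),\,\ldots,\,k+1\big) & \text{if } m\ge 0,\\ \big((2k+1)(-m-1)+k,\,(2k+1)(-m-2)+k,\,\ldots,\,k\big) & \text{if } m<0.\end{cases}$$ Let $S_{k,m}(n)$ be the set of tuples $(s_1,\ldots,s_k;\alpha,\beta,\gamma,\xi)$, where $\alpha,\beta,\gamma,\xi$ are partitions, such that 1. $s_1\ge s_2\ge\cdots\ge s_k$ are nonnegative integers, and $s_k\ge |m|$; 2. all parts of $\alpha$ are at least $s_k$, the $i$-th successive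 Durfee square of $\alpha$ has side $s_i$ for $1\le i\le k$, and $\alpha$ has no parts below its $k$-th Durfee square; 3. all parts of $\beta$ are strictly larger than $s_k$ and at most $2s_k$; 4. $\gamma=(m,m-1,\ldots,1)$ if $m\ge 0$, and $\gamma=(-m-1,-m-2,\ldots,1)$ if $m<0$; 5. $\xi$ has at most $s_k+m$ parts, and all its parts are at most $s_k-m$; 6. $|\alpha|+|\beta|+|\gamma|+|\xi|=n$. **Theorem.** For every integer $m$ and all positive integers $k,n$ there exists a bijection $\chi$ between $R_{k,m}(n)$ and $S_{k,m}(n)$. -/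

import Mathlib

/-- An integer partition (of an arbitrary natural number): its size together with a
partition of that size in the sense of Mathlib (a multiset of positive parts). -/
abbrev IntPartition : Type := Σ a : ℕ, Nat.Partition a

namespace IntPartition

/-- The weight (sum of all the parts). -/
def size (p : IntPartition) : ℕ := p.1

/-- The multiset of parts. -/
def parts (p : IntPartition) : Multiset ℕ := p.2.parts

/-- The parts, written as a non-increasing list. -/
def rows (p : IntPartition) : List ℕ := p.parts.sort (fun a b => b ≤ a)

end IntPartition

/-- Side of the Durfee square: the largest `d` such that at least `d` of the parts are
at least `d`. -/
def durfeeSide (l : List ℕ) : ℕ :=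
  Nat.findGreatest (fun d => d ≤ l.countP (fun x => decide (d ≤ x))) l.length

/-- The parts lying below the Durfee square of the partition with non-increasing list of
parts `l`. -/
def belowDurfee (l : List ℕ) : List ℕ := l.drop (durfeeSide l)

/-- The parts of `p` lying below its first `i` successive Durfee squares. -/
def IntPartition.belowSquares (p : IntPartition) (i : ℕ) : List ℕ := belowDurfee^[i] p.rows

/-- Side of the successive Durfee square number `i + 1` of `p`: the Durfee square of the
partition formed by the parts below the first `i` successive Durfee squares (it is `0` if there
are at most `i` of them). -/
def IntPartition.succDurfee (p : IntPartition) (i : ℕ) : ℕ := durfeeSide (p.belowSquares i)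

/-- The parts of the explicit partition `δ`: for `j = |m| - 1, …, 1, 0` the numbers
`(2k+1) j + (k+1)` if `m ≥ 0`, and `(2k+1) j + k` if `m < 0`. -/
def deltaParts (k : ℕ) (m : ℤ) : Multiset ℕ :=
  if 0 ≤ m then (Multiset.range m.natAbs).map (fun j => (2 * k + 1) * j + (k + 1))
  else (Multiset.range m.natAbs).map (fun j => (2 * k + 1) * j + k)

/-- The parts of the explicit partition `γ`: `m, m - 1, …, 1` if `m ≥ 0`, and
`-m - 1, -m - 2, …, 1` if `m < 0`. -/
def gammaParts (m : ℤ) : Multiset ℕ :=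
  if 0 ≤ m then (Multiset.range m.natAbs).map (fun j => j + 1)
  else (Multiset.range (m.natAbs - 1)).map (fun j => j + 1)

/-- The set `R_{k,m}(n)` of pairs `(λ, δ)`. -/
structure PairSetR (k : ℕ) (m : ℤ) (n : ℕ) where
  lam : IntPartition
  delta : IntPartition
  delta_parts : delta.parts = deltaParts k m
  size_eq : lam.size + delta.size = n

/-- The last entry `s_k` of a sequence `(s_1, …, s_k)`, where `k ≥ 1`
(`s_i` is the value at the index `i - 1`). -/
def lastEntry {k : ℕ} (hk : 1 ≤ k) (s : Fin k → ℕ) : ℕ := s ⟨k - 1, Nat.sub_lt hk Nat.one_pos⟩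

/-- The set `S_{k,m}(n)` of tuples `(s_1, …, s_k; α, β, γ, ξ)`. -/
structure TupleSetS (k : ℕ) (hk : 1 ≤ k) (m : ℤ) (n : ℕ) where
  s : Fin k → ℕ
  alpha : IntPartition
  beta : IntPartition
  gamma : IntPartition
  xi : IntPartition
  /-- `s_1 ≥ s_2 ≥ ⋯ ≥ s_k`. -/
  s_antitone : Antitone s
  /-- All parts of `α` are at least `s_k`. -/
  alpha_ge : ∀ x ∈ alpha.parts, lastEntry hk s ≤ x
  /-- The successive Durfee squares of `α` have sides `s_1, …, s_k`. -/
  alpha_durfee : ∀ i : Fin k, alpha.succDurfee i = s i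
  /-- `α` has no part below its `k`-th Durfee square. -/
  alpha_end : alpha.belowSquares k = []
  /-- All parts of `β` lie in `[s_k + 1, 2 s_k]`. -/
  beta_mem : ∀ x ∈ beta.parts, lastEntry hk s < x ∧ x ≤ 2 * lastEntry hk s
  /-- `γ` is the prescribed staircase. -/
  gamma_parts : gamma.parts = gammaParts m
  /-- The bounds `s_k + m` and `s_k - m` on `ξ` are nonnegative: `|m| ≤ s_k`. -/
  abs_le : |m| ≤ (lastEntry hk s : ℤ)
  /-- `ξ` has at most `s_k + m` parts. -/
  xi_card : (xi.parts.card : ℤ) ≤ (lastEntry hk s : ℤ) + m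
  /-- All parts of `ξ` are at most `s_k - m`. -/
  xi_le : ∀ x ∈ xi.parts, (x : ℤ) ≤ (lastEntry hk s : ℤ) - m
  size_eq : alpha.size + beta.size + gamma.size + xi.size = n

/-! Both sets are finite, so it suffices that their generating functions agree in degree `n`; the
bijection is not constructed explicitly. Write `(q)_j` for `qfac j`, `M = |m|`, and `L = n + M`, a
bound on parts that is vacuous at weight `n`.

For fixed `s = s_k`, the partitions `β` contribute `(q)_s / (q)_{2s}` and the partitions `ξ`
contribute `(q)_{2s} / ((q)_{s-M} (q)_{s+M})`. Their product is `B(s) = (q)_s / ((q)_{s-M}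
(q)_{s+M})`, which is `baileyTerm M s`. Removing from `α` a Durfee square of side `d`, together with
the rows to its right, replaces the bound `L` by `d` and contributes `q^{d^2}` times the
`q`-binomial of `L` over `d`.

The decisive identity is that `B` is an eigenvector of this operation (`sum_qbin_mul_baileyTerm`, a
Bailey-type identity): the sum over `d` gives `q^{M^2} B(L)`. After `k` squares the total is `q^{k
M^2} B(L)` (`isGF_durfeePairs`). Up to degree `n`, `B(L)` agrees with `1/(q)_L`, the series for `λ`
(`coeff_baileyTerm`), and `|δ| = k M^2 + |γ|` (`sum_deltaParts`). -/

open PowerSeries in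
/-- The set `S`, weighted by `w`, has finitely many elements of each weight and its generating
function is `f`. -/
def IsGF {α : Type*} (S : Set α) (w : α → ℕ) (f : PowerSeries ℚ) : Prop :=
  ∃ F : ℕ → Finset α, (∀ n x, x ∈ F n ↔ x ∈ S ∧ w x = n) ∧ ∀ n, ((F n).card : ℚ) = coeff n f

/-! ### Calculus of generating functions of weighted sets -/

namespace IsGF
open PowerSeries

variable {α β : Type*} {S : Set α} {T : Set β} {w : α → ℕ} {v : β → ℕ} {f g : PowerSeries ℚ}

theorem unique (hf : IsGF S w f) (hg : IsGF S w g) : f = g := by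
  obtain ⟨F, hF, hFc⟩ := hf
  obtain ⟨G, hG, hGc⟩ := hg
  ext n
  rw [← hFc, ← hGc]
  congr 2
  ext x
  rw [hF, hG]

theorem exists_of_finite (h : ∀ n, {x | x ∈ S ∧ w x = n}.Finite) : ∃ f, IsGF S w f :=
  ⟨mk fun n => ((h n).toFinset.card : ℚ), fun n => (h n).toFinset, by simp, by simp⟩

theorem empty (w : α → ℕ) : IsGF ∅ w 0 := ⟨fun _ => ∅, by simp, by simp⟩

theorem singleton (a : α) (h : w a = 0) : IsGF {a} w 1 := by
  classical
  refine ⟨fun n => if n = 0 then {a} else ∅, fun n x => ?_, fun n => ?_⟩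
  · dsimp only
    split_ifs with hn
    · simp only [Finset.mem_singleton, Set.mem_singleton_iff]
      constructor
      · rintro rfl; simp [h, hn]
      · exact fun h => h.1
    · simp only [Finset.notMem_empty, Set.mem_singleton_iff, false_iff, not_and]
      rintro rfl; omega
  · dsimp only
    rw [coeff_one]
    split_ifs <;> simp

theorem image (φ : α → β) (hf : IsGF S w f) (hφ : Set.BijOn φ S T)
    (hw : ∀ x ∈ S, v (φ x) = w x) : IsGF T v f := by
  classical
  obtain ⟨F, hF, hFc⟩ := hf
  refine ⟨fun n => (F n).image φ, fun n y => ?_, fun n => ?_⟩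
  · simp only [Finset.mem_image, hF]
    constructor
    · rintro ⟨x, ⟨hx, rfl⟩, rfl⟩
      exact ⟨hφ.mapsTo hx, hw x hx⟩
    · rintro ⟨hy, rfl⟩
      obtain ⟨x, hx, rfl⟩ := hφ.surjOn hy
      exact ⟨x, ⟨hx, (hw x hx).symm⟩, rfl⟩
  · rw [Finset.card_image_of_injOn, hFc]
    intro x hx y hy h
    exact hφ.injOn ((hF n x).1 hx).1 ((hF n y).1 hy).1 h

theorem prod (hf : IsGF S w f) (hg : IsGF T v g) :
    IsGF (S ×ˢ T) (fun x => w x.1 + v x.2) (f * g) := by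
  classical
  obtain ⟨F, hF, hFc⟩ := hf
  obtain ⟨G, hG, hGc⟩ := hg
  refine ⟨fun n => (Finset.HasAntidiagonal.antidiagonal n).biUnion fun p => F p.1 ×ˢ G p.2,
    fun n y => ?_, fun n => ?_⟩
  · simp only [Finset.mem_biUnion, Finset.HasAntidiagonal.mem_antidiagonal, Finset.mem_product, hF, hG,
      Set.mem_prod]
    constructor
    · rintro ⟨p, rfl, ⟨h1, h2⟩, h3, h4⟩
      exact ⟨⟨h1, h3⟩, by rw [h2, h4]⟩
    · rintro ⟨⟨h1, h3⟩, h⟩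
      exact ⟨(w y.1, v y.2), h, ⟨h1, rfl⟩, h3, rfl⟩
  · rw [Finset.card_biUnion, coeff_mul]
    · push_cast
      exact Finset.sum_congr rfl fun p _ => by rw [Finset.card_product]; push_cast; rw [hFc, hGc]
    · intro p _ r _ hne
      rw [Function.onFun, Finset.disjoint_left]
      rintro x h1 h2
      simp only [Finset.mem_product, hF, hG] at h1 h2
      exact hne (Prod.ext (h1.1.2.symm.trans h2.1.2) (h1.2.2.symm.trans h2.2.2))

theorem biUnion {ι : Type*} (s : Finset ι) {A : ι → Set α} {φ : ι → PowerSeries ℚ}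
    (h : ∀ i ∈ s, IsGF (A i) w (φ i)) (hS : ∀ x, x ∈ S ↔ ∃ i ∈ s, x ∈ A i)
    (hd : ∀ i ∈ s, ∀ j ∈ s, ∀ x ∈ A i, x ∈ A j → i = j) :
    IsGF S w (∑ i ∈ s, φ i) := by
  classical
  choose! F hF hFc using h
  refine ⟨fun n => s.biUnion fun i => F i n, fun n x => ?_, fun n => ?_⟩
  · simp only [Finset.mem_biUnion, hS]
    constructor
    · rintro ⟨i, hi, hx⟩
      rw [hF i hi] at hx
      exact ⟨⟨i, hi, hx.1⟩, hx.2⟩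
    · rintro ⟨⟨i, hi, hx⟩, hw⟩
      exact ⟨i, hi, (hF i hi n x).2 ⟨hx, hw⟩⟩
  · rw [Finset.card_biUnion, map_sum]
    · push_cast
      exact Finset.sum_congr rfl fun i hi => hFc i hi n
    · intro i hi j hj hne
      rw [Function.onFun, Finset.disjoint_left]
      intro x h1 h2
      exact hne (hd i hi j hj x ((hF i hi n x).1 h1).1 ((hF j hj n x).1 h2).1)

theorem union {A B : Set α} (hf : IsGF A w f) (hg : IsGF B w g)
    (hS : ∀ x, x ∈ S ↔ x ∈ A ∨ x ∈ B) (hd : ∀ x ∈ A, x ∉ B) : IsGF S w (f + g) := by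
  have := biUnion (S := S) (w := w) (Finset.univ : Finset Bool) (A := fun b => cond b A B)
    (φ := fun b => cond b f g) (by rintro (_ | _) _ <;> simpa) (by simpa [or_comm] using hS)
    (by
      rintro (_ | _) _ (_ | _) _ x h1 h2
      · rfl
      · exact absurd h1 (hd x h2)
      · exact absurd h2 (hd x h1)
      · rfl)
  simpa using this

theorem shift (c : ℕ) (hf : IsGF S w f) : IsGF S (fun x => w x + c) (X ^ c * f) := by
  obtain ⟨F, hF, hFc⟩ := hf
  refine ⟨fun n => if c ≤ n then F (n - c) else ∅, fun n x => ?_, fun n => ?_⟩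
  · dsimp only
    split_ifs with h
    · rw [hF]
      exact and_congr_right fun _ => by omega
    · simp only [Finset.notMem_empty, false_iff, not_and]
      omega
  · dsimp only
    rw [coeff_X_pow_mul']
    split_ifs with h
    · exact hFc _
    · simp

theorem image_shift (c : ℕ) (φ : α → β) (hf : IsGF S w f) (hφ : Set.BijOn φ S T)
    (hw : ∀ x ∈ S, v (φ x) = w x + c) : IsGF T v (X ^ c * f) :=
  (hf.shift c).image φ hφ hw

/-- Equal coefficients mean equally large finite fibres. The maps `φ` and `ψ` encode the two types
as these fibres. -/
theorem exists_bijective {γ δ : Type*} (hf : IsGF S w f) (hg : IsGF T v g) {n : ℕ}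
    (h : coeff n f = coeff n g) (φ : γ → α) (hφ : Function.Injective φ)
    (hφr : ∀ x, (∃ c, φ c = x) ↔ x ∈ S ∧ w x = n) (ψ : δ → β) (hψ : Function.Injective ψ)
    (hψr : ∀ x, (∃ c, ψ c = x) ↔ x ∈ T ∧ v x = n) : ∃ χ : γ → δ, Function.Bijective χ := by
  obtain ⟨F, hF, hFc⟩ := hf
  obtain ⟨G, hG, hGc⟩ := hg
  have hc : (F n).card = (G n).card := by
    have := (hFc n).trans (h.trans (hGc n).symm)
    exact_mod_cast this
  have e1 : Function.Bijective (fun c => (⟨φ c, (hF n _).2 ((hφr _).1 ⟨c, rfl⟩)⟩ : F n)) :=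
    ⟨fun a b hab => hφ (congrArg Subtype.val hab), fun ⟨x, hx⟩ => by
      obtain ⟨c, hc⟩ := (hφr x).2 ((hF n x).1 hx)
      exact ⟨c, Subtype.ext hc⟩⟩
  have e2 : Function.Bijective (fun c => (⟨ψ c, (hG n _).2 ((hψr _).1 ⟨c, rfl⟩)⟩ : G n)) :=
    ⟨fun a b hab => hψ (congrArg Subtype.val hab), fun ⟨x, hx⟩ => by
      obtain ⟨c, hc⟩ := (hψr x).2 ((hG n x).1 hx)
      exact ⟨c, Subtype.ext hc⟩⟩
  let e := ((Equiv.ofBijective _ e1).trans (Finset.equivOfCardEq hc)).trans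
    (Equiv.ofBijective _ e2).symm
  exact ⟨e, e.bijective⟩

end IsGF

/-! ### Identities for `q`-factorials and `q`-binomials -/

section qSeries
open PowerSeries

/-- The `q`-Pochhammer symbol `(q; q)_n`. -/
noncomputable def qfac (n : ℕ) : PowerSeries ℚ := ∏ i ∈ Finset.range n, (1 - X ^ (i + 1))

/-- The inverse of `(q; q)_n`. -/
noncomputable def qfacInv (n : ℕ) : PowerSeries ℚ := (qfac n)⁻¹

theorem qfac_zero : qfac 0 = 1 := by simp [qfac]

theorem qfac_succ (n : ℕ) : qfac (n + 1) = qfac n * (1 - X ^ (n + 1)) :=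
  Finset.prod_range_succ _ _

theorem qfac_mul_qfacInv (n : ℕ) : qfac n * qfacInv n = 1 := by
  apply PowerSeries.mul_inv_cancel
  rw [qfac, map_prod, Finset.prod_ne_zero_iff]
  intro i _
  simp

theorem qfacInv_zero : qfacInv 0 = 1 := by
  have := qfac_mul_qfacInv 0
  rwa [qfac_zero, one_mul] at this

theorem qfacInv_eq (n : ℕ) : qfacInv n = qfacInv (n + 1) * (1 - X ^ (n + 1)) := by
  have h1 := qfac_mul_qfacInv n
  have h2 := qfac_mul_qfacInv (n + 1)
  rw [qfac_succ] at h2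
  linear_combination (qfacInv (n + 1) * (1 - X ^ (n + 1))) * h1 - qfacInv n * h2

/-- The `q`-binomial coefficient. -/
noncomputable def qbin (n j : ℕ) : PowerSeries ℚ :=
  if j ≤ n then qfac n * qfacInv (n - j) * qfacInv j else 0

theorem qbin_add (a b : ℕ) : qbin (a + b) a = qfac (a + b) * qfacInv b * qfacInv a := by
  simp [qbin]

theorem qbin_zero (n : ℕ) : qbin n 0 = 1 := by
  simp [qbin, qfac_mul_qfacInv, qfacInv_zero]

theorem qbin_self (n : ℕ) : qbin n n = 1 := by
  simp [qbin, qfac_mul_qfacInv, qfacInv_zero]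

theorem qbin_of_lt {n j : ℕ} (h : n < j) : qbin n j = 0 := if_neg (by omega)

theorem qbin_succ_succ (n j : ℕ) (h : j ≤ n) :
    qbin (n + 1) (j + 1) = qbin n (j + 1) + X ^ (n - j) * qbin n j := by
  obtain ⟨b, rfl⟩ := Nat.exists_eq_add_of_le h
  rw [Nat.add_sub_cancel_left]
  rcases b with _ | b
  · rw [add_zero, qbin_of_lt (Nat.lt_succ_self j), qbin_self, qbin_self]
    simp
  · have h1 := qbin_add (j + 1) (b + 1)
    have h2 := qbin_add (j + 1) b
    have h3 := qbin_add j (b + 1)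
    rw [show j + 1 + (b + 1) = j + 1 + b + 1 by ring, qfac_succ] at h1
    rw [show j + (b + 1) = j + 1 + b by ring] at h3 ⊢
    rw [h1, h2, h3, qfacInv_eq b, qfacInv_eq j]
    ring

theorem qbin_pascal (a b : ℕ) :
    qbin (a + 1 + (b + 1)) (a + 1) =
      qbin (a + 1 + b) (a + 1) + X ^ (b + 1) * qbin (a + (b + 1)) a := by
  have := qbin_succ_succ (a + (b + 1)) a (by omega)
  rw [Nat.add_sub_cancel_left] at this
  rw [show a + 1 + (b + 1) = a + (b + 1) + 1 by ring, this,
    show a + (b + 1) = a + 1 + b by ring]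

/-- Combinatorially, a partition with parts at most `N + c` is cut at its Durfee rectangle with `j`
rows and `j + c` columns. In the induction, Pascal's rule splits the sum for `N + 1` into those for
`(N, c)` and `(N, c + 1)`, hence the general `c`. -/
theorem sum_qbin_mul_qfacInv (N c : ℕ) :
    ∑ j ∈ Finset.range (N + 1), X ^ (j * (j + c)) * qbin N j * qfacInv (j + c) =
      qfacInv (N + c) := by
  induction N generalizing c with
  | zero => simp [qbin_self]
  | succ N ih =>
    have h1 : ∀ j ∈ Finset.range (N + 1),
        X ^ ((j + 1) * (j + 1 + c)) * qbin (N + 1) (j + 1) * qfacInv (j + 1 + c) =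
          X ^ ((j + 1) * (j + 1 + c)) * qbin N (j + 1) * qfacInv (j + 1 + c) +
          X ^ (N + c + 1) * (X ^ (j * (j + (c + 1))) * qbin N j * qfacInv (j + (c + 1))) := by
      intro j hj
      have hj' : j ≤ N := Nat.lt_succ_iff.1 (Finset.mem_range.1 hj)
      obtain ⟨b, rfl⟩ := Nat.exists_eq_add_of_le hj'
      -- The exponents match because `(j+1)(j+1+c) + (N-j) = (N+c+1) + j(j+c+1)`.
      rw [qbin_succ_succ _ _ hj', Nat.add_sub_cancel_left, show j + (c + 1) = j + 1 + c by ring]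
      ring
    rw [Finset.sum_range_succ', Finset.sum_congr rfl h1, Finset.sum_add_distrib,
      ← Finset.mul_sum, ih (c + 1)]
    -- The induction hypothesis for `c` is extended by its vanishing term `j = N + 1`, then its term
    -- `j = 0` is split off to match the shifted sum.
    have h2 := Finset.sum_range_succ'
      (fun j => X ^ (j * (j + c)) * qbin N j * qfacInv (j + c)) (N + 1)
    rw [Finset.sum_range_succ, ih c, qbin_of_lt (Nat.lt_succ_self N), qbin_zero] at h2
    rw [qbin_zero, show N + (c + 1) = N + c + 1 by ring, show N + 1 + c = N + c + 1 by ring]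
    linear_combination qfacInv_eq (N + c) - h2

/-- The function `(q)_s / ((q)_{s-M} (q)_{s+M})`. -/
noncomputable def baileyTerm (M s : ℕ) : PowerSeries ℚ :=
  if M ≤ s then qfac s * qfacInv (s - M) * qfacInv (s + M) else 0

/-- Only `d = M + j` contributes. Since `(M+j)^2 = M^2 + j(j+2M)` and the factor `(q)_d` cancels,
the sum becomes `sum_qbin_mul_qfacInv` with `c = 2M`. -/
theorem sum_qbin_mul_baileyTerm (M L : ℕ) :
    ∑ d ∈ Finset.range (L + 1), qbin L d * X ^ (d ^ 2) * baileyTerm M d =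
      X ^ (M ^ 2) * baileyTerm M L := by
  rcases lt_or_ge L M with h | h
  · rw [baileyTerm, if_neg (by omega), mul_zero]
    refine Finset.sum_eq_zero fun d hd => ?_
    rw [Finset.mem_range] at hd
    rw [baileyTerm, if_neg (by omega), mul_zero]
  · obtain ⟨N, rfl⟩ := Nat.exists_eq_add_of_le h
    rw [show M + N + 1 = M + (N + 1) by ring, Finset.sum_range_add,
      Finset.sum_eq_zero, zero_add]
    · have hN := sum_qbin_mul_qfacInv N (2 * M)
      rw [baileyTerm, if_pos (by omega), Nat.add_sub_cancel_left,
        show M + N + M = N + 2 * M by ring, ← hN, Finset.mul_sum, Finset.mul_sum]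
      refine Finset.sum_congr rfl fun j hj => ?_
      have hj' : j ≤ N := Nat.lt_succ_iff.1 (Finset.mem_range.1 hj)
      rw [qbin, if_pos (by omega), baileyTerm, if_pos (by omega), qbin, if_pos hj',
        Nat.add_sub_cancel_left, show M + N - (M + j) = N - j by omega,
        show M + j + M = j + 2 * M by ring]
      linear_combination (X ^ ((M + j) ^ 2) * qfac (M + N) * qfacInv (N - j) * qfacInv j *
        qfacInv (j + 2 * M)) * qfac_mul_qfacInv (M + j) -
        (X ^ ((M + j) ^ 2) * qfac (M + N) * qfacInv (N - j) * qfacInv j *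
        qfacInv (j + 2 * M)) * qfac_mul_qfacInv N
    · intro d hd
      rw [Finset.mem_range] at hd
      rw [baileyTerm, if_neg (by omega), mul_zero]

theorem trunc_qfacInv (n a : ℕ) : ∃ r, qfacInv (n + a) = qfacInv n + X ^ (n + 1) * r := by
  induction a with
  | zero => exact ⟨0, by simp⟩
  | succ a ih =>
    obtain ⟨r, hr⟩ := ih
    refine ⟨r + X ^ a * qfacInv (n + a + 1), ?_⟩
    have := qfacInv_eq (n + a)
    rw [← add_assoc]
    rw [hr] at this
    linear_combination -this

/-- All three indices `n`, `n + M`, `n + 2M` are at least `n`, so the inverse `q`-factorials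
coincide modulo `X ^ (n + 1)` and one of them cancels against `qfac (n + M)`. -/
theorem coeff_baileyTerm (n M i : ℕ) (hi : i ≤ n) :
    coeff i (baileyTerm M (n + M)) = coeff i (qfacInv (n + M)) := by
  obtain ⟨r, hr⟩ := trunc_qfacInv n M
  obtain ⟨t, ht⟩ := trunc_qfacInv n (M + M)
  have h1 := qfac_mul_qfacInv (n + M)
  have : baileyTerm M (n + M) = qfacInv (n + M) + X ^ (n + 1) *
      (qfac (n + M) * qfacInv n * t - r * qfac (n + M) * qfacInv n - r) := by
    rw [baileyTerm, if_pos (by omega), Nat.add_sub_cancel, add_assoc n M M, ht]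
    rw [hr] at h1 ⊢
    linear_combination qfacInv n * h1
  rw [this, map_add, coeff_X_pow_mul', if_neg (by omega), add_zero]

end qSeries

/-! ### Partitions as non-increasing lists, and their generating functions -/

section Lists
open PowerSeries

/-- Non-increasing lists with all entries in `(a, b]`. -/
def partsIn (a b : ℕ) : Set (List ℕ) :=
  {l | l.Pairwise (fun x y => y ≤ x) ∧ ∀ x ∈ l, a < x ∧ x ≤ b}

/-- Non-increasing lists of length `a` with all entries at most `b`. -/
def listBox (a b : ℕ) : Set (List ℕ) :=
  {l | l.Pairwise (fun x y => y ≤ x) ∧ l.length = a ∧ ∀ x ∈ l, x ≤ b}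

/-- Non-increasing lists of at most `a` positive entries, all of them at most `b`. -/
def partBox (a b : ℕ) : Set (List ℕ) :=
  {l | l.Pairwise (fun x y => y ≤ x) ∧ l.length ≤ a ∧ ∀ x ∈ l, 0 < x ∧ x ≤ b}

theorem sort_coe_of_pairwise {l : List ℕ} (h : l.Pairwise (fun x y => y ≤ x)) :
    (l : Multiset ℕ).sort (fun a b => b ≤ a) = l :=
  List.mergeSort_of_pairwise (by simpa using h)

theorem finite_partsIn (a b n : ℕ) : {l | l ∈ partsIn a b ∧ l.sum = n}.Finite := by
  refine (Set.finite_range fun p : Nat.Partition n =>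
    p.parts.sort (fun a b => b ≤ a)).subset ?_
  rintro l ⟨⟨hl, hp⟩, rfl⟩
  exact ⟨⟨l, fun {i} hi => Nat.zero_lt_of_lt (hp i hi).1, rfl⟩, sort_coe_of_pairwise hl⟩

theorem mem_partsIn_succ {a b : ℕ} (h : a ≤ b) (l : List ℕ) :
    l ∈ partsIn a (b + 1) ↔ l ∈ partsIn a b ∨ l ∈ (List.cons (b + 1)) '' partsIn a (b + 1) := by
  constructor
  · rintro ⟨hl, hp⟩
    rcases l with _ | ⟨x, l⟩
    · exact Or.inl ⟨hl, by simp⟩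
    · rw [List.pairwise_cons] at hl
      have hx := hp x (by simp)
      rcases Nat.lt_or_ge x (b + 1) with hb | hb
      · refine Or.inl ⟨List.pairwise_cons.2 hl, fun y hy => ⟨(hp y hy).1, ?_⟩⟩
        rcases List.mem_cons.1 hy with rfl | hy
        · omega
        · have := hl.1 y hy
          omega
      · obtain rfl : x = b + 1 := by omega
        exact Or.inr ⟨l, ⟨hl.2, fun y hy => hp y (by simp [hy])⟩, rfl⟩
  · rintro (⟨hl, hp⟩ | ⟨l, ⟨hl, hp⟩, rfl⟩)
    · exact ⟨hl, fun x hx => ⟨(hp x hx).1, by have := (hp x hx).2; omega⟩⟩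
    · refine ⟨List.pairwise_cons.2 ⟨fun x hx => (hp x hx).2, hl⟩, fun x hx => ?_⟩
      rcases List.mem_cons.1 hx with rfl | hx
      · omega
      · exact hp x hx

/-- Removing one part equal to the upper bound gives a linear equation for the unknown series `f`.
Finiteness is used first so that `f` exists and the equation can be solved. -/
theorem isGF_partsIn (a c : ℕ) : IsGF (partsIn a (a + c)) List.sum (qfac a * qfacInv (a + c)) := by
  induction c with
  | zero =>
    rw [add_zero, qfac_mul_qfacInv]
    convert IsGF.singleton (w := List.sum) ([] : List ℕ) rfl
    ext l
    constructor
    · rintro ⟨-, h⟩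
      rcases l with _ | ⟨x, l⟩
      · rfl
      · have := h x (by simp)
        omega
    · rintro rfl
      exact ⟨List.Pairwise.nil, by simp⟩
  | succ c ih =>
    obtain ⟨f, hf⟩ := IsGF.exists_of_finite (finite_partsIn a (a + c + 1))
    have h1 : IsGF (List.cons (a + c + 1) '' partsIn a (a + c + 1)) List.sum
        (X ^ (a + c + 1) * f) :=
      hf.image_shift _ _ (List.cons_injective.injOn.bijOn_image)
        fun l _ => by simp [add_comm]
    have h2 := hf.unique (ih.union h1 (mem_partsIn_succ (by omega)) (by
      rintro _ ⟨-, h⟩ ⟨l, -, rfl⟩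
      have := h _ (List.mem_cons_self)
      omega))
    have h3 := qfacInv_eq (a + c)
    have h4 := qfac_mul_qfacInv (a + c + 1)
    rw [qfac_succ] at h4
    have h5 : f = qfac a * qfacInv (a + (c + 1)) := by
      rw [h3] at h2
      rw [← add_assoc]
      linear_combination (qfac (a + c) * qfacInv (a + c + 1)) * h2 -
        (f - qfac a * qfacInv (a + c + 1)) * h4
    rw [← h5]
    exact hf

/-- The recursion on the first entry is Pascal's rule. It is stated abstractly to serve both
`listBox` (rows beside a Durfee square, zeros allowed) and `partBox` (the partition `ξ`). -/
theorem isGF_qbin (B : ℕ → ℕ → Set (List ℕ)) (h0 : ∀ b, B 0 b = {[]})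
    (h1 : ∀ a, ∃ l, l.sum = 0 ∧ B a 0 = {l})
    (hs : ∀ a b l, l ∈ B (a + 1) (b + 1) ↔
      l ∈ B (a + 1) b ∨ l ∈ List.cons (b + 1) '' B a (b + 1))
    (hle : ∀ a b, ∀ l ∈ B a b, ∀ x ∈ l, x ≤ b) (a b : ℕ) :
    IsGF (B a b) List.sum (qbin (a + b) a) := by
  induction a generalizing b with
  | zero =>
    rw [h0, qbin_zero]
    exact IsGF.singleton _ rfl
  | succ a iha =>
    induction b with
    | zero =>
      obtain ⟨l, hl, h⟩ := h1 (a + 1)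
      rw [h, add_zero, qbin_self]
      exact IsGF.singleton _ hl
    | succ b ihb =>
      rw [qbin_pascal]
      refine ihb.union ((iha (b + 1)).image_shift (b + 1) (List.cons (b + 1))
        (List.cons_injective.injOn.bijOn_image) fun l _ => by simp [add_comm]) (hs a b) ?_
      rintro _ h ⟨l, -, rfl⟩
      have := hle _ _ _ h _ List.mem_cons_self
      omega

theorem isGF_listBox (a b : ℕ) : IsGF (listBox a b) List.sum (qbin (a + b) a) := by
  refine isGF_qbin listBox ?_ ?_ ?_ (fun a b l h => h.2.2) a b
  · intro b
    ext l
    constructor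
    · rintro ⟨-, h, -⟩
      exact List.length_eq_zero_iff.1 h
    · rintro rfl
      exact ⟨List.Pairwise.nil, rfl, by simp⟩
  · intro a
    refine ⟨List.replicate a 0, by simp, ?_⟩
    ext l
    constructor
    · rintro ⟨-, h, h'⟩
      exact List.eq_replicate_iff.2 ⟨h, fun x hx => Nat.le_zero.1 (h' x hx)⟩
    · rintro rfl
      exact ⟨by simp [List.pairwise_replicate], by simp, fun x hx => (List.eq_of_mem_replicate hx).le⟩
  · intro a b l
    constructor
    · rintro ⟨hl, hlen, hp⟩
      rcases l with _ | ⟨x, l⟩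
      · simp at hlen
      · rw [List.pairwise_cons] at hl
        have hx := hp x (by simp)
        rcases Nat.lt_or_ge x (b + 1) with hb | hb
        · refine Or.inl ⟨List.pairwise_cons.2 hl, hlen, fun y hy => ?_⟩
          rcases List.mem_cons.1 hy with rfl | hy
          · omega
          · have := hl.1 y hy
            omega
        · obtain rfl : x = b + 1 := by omega
          exact Or.inr ⟨l, ⟨hl.2, by simpa using hlen, fun y hy => hp y (by simp [hy])⟩, rfl⟩
    · rintro (⟨hl, hlen, hp⟩ | ⟨l, ⟨hl, hlen, hp⟩, rfl⟩)
      · exact ⟨hl, hlen, fun x hx => (hp x hx).trans (Nat.le_succ b)⟩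
      · refine ⟨List.pairwise_cons.2 ⟨hp, hl⟩, by simpa using hlen, fun x hx => ?_⟩
        rcases List.mem_cons.1 hx with rfl | hx
        · omega
        · exact hp x hx

theorem isGF_partBox (a b : ℕ) : IsGF (partBox a b) List.sum (qbin (a + b) a) := by
  refine isGF_qbin partBox ?_ ?_ ?_ (fun a b l h x hx => (h.2.2 x hx).2) a b
  · intro b
    ext l
    constructor
    · rintro ⟨-, h, -⟩
      exact List.length_eq_zero_iff.1 (Nat.le_zero.1 h)
    · rintro rfl
      exact ⟨List.Pairwise.nil, le_rfl, by simp⟩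
  · intro a
    refine ⟨[], rfl, ?_⟩
    ext l
    constructor
    · rintro ⟨-, -, h⟩
      rcases l with _ | ⟨x, l⟩
      · rfl
      · have := h x (by simp)
        omega
    · rintro rfl
      exact ⟨List.Pairwise.nil, by simp, by simp⟩
  · intro a b l
    constructor
    · rintro ⟨hl, hlen, hp⟩
      rcases l with _ | ⟨x, l⟩
      · exact Or.inl ⟨hl, hlen, by simp⟩
      · rw [List.pairwise_cons] at hl
        have hx := hp x (by simp)
        rcases Nat.lt_or_ge x (b + 1) with hb | hb
        · refine Or.inl ⟨List.pairwise_cons.2 hl, hlen, fun y hy => ⟨(hp y hy).1, ?_⟩⟩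
          rcases List.mem_cons.1 hy with rfl | hy
          · omega
          · have := hl.1 y hy
            omega
        · obtain rfl : x = b + 1 := by omega
          exact Or.inr ⟨l, ⟨hl.2, by simpa using hlen, fun y hy => hp y (by simp [hy])⟩, rfl⟩
    · rintro (⟨hl, hlen, hp⟩ | ⟨l, ⟨hl, hlen, hp⟩, rfl⟩)
      · exact ⟨hl, hlen, fun x hx => ⟨(hp x hx).1, (hp x hx).2.trans (Nat.le_succ b)⟩⟩
      · refine ⟨List.pairwise_cons.2 ⟨fun x hx => (hp x hx).2, hl⟩, by simpa using hlen,
          fun x hx => ?_⟩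
        rcases List.mem_cons.1 hx with rfl | hx
        · omega
        · exact hp x hx

/-! ### Durfee squares of non-increasing lists -/

theorem durfeeSide_le_countP (l : List ℕ) :
    durfeeSide l ≤ l.countP (fun x => decide (durfeeSide l ≤ x)) :=
  Nat.findGreatest_spec (P := fun d => d ≤ l.countP (fun x => decide (d ≤ x)))
    (Nat.zero_le l.length) (Nat.zero_le _)

theorem durfeeSide_le_length (l : List ℕ) : durfeeSide l ≤ l.length := Nat.findGreatest_le _

theorem le_durfeeSide {l : List ℕ} {d : ℕ} (h : d ≤ l.countP (fun x => decide (d ≤ x))) :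
    d ≤ durfeeSide l :=
  Nat.le_findGreatest (h.trans List.countP_le_length) h

theorem le_of_mem_take_countP {l : List ℕ} (hl : l.Pairwise (fun x y => y ≤ x)) (t : ℕ) :
    ∀ x ∈ l.take (l.countP fun x => decide (t ≤ x)), t ≤ x := by
  induction l with
  | nil => simp
  | cons a l ih =>
    rw [List.pairwise_cons] at hl
    by_cases h : t ≤ a
    · rw [List.countP_cons_of_pos (by simpa using h), List.take_succ_cons]
      intro x hx
      rcases List.mem_cons.1 hx with rfl | hx
      · exact h
      · exact ih hl.2 x hx
    · have : (a :: l).countP (fun x => decide (t ≤ x)) = 0 := by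
        rw [List.countP_eq_zero]
        intro x hx
        rcases List.mem_cons.1 hx with rfl | hx
        · simpa using h
        · have := hl.1 x hx
          simp only [decide_eq_true_eq]
          omega
      rw [this]
      simp

theorem durfeeSide_le_of_mem_take {l : List ℕ} (hl : l.Pairwise (fun x y => y ≤ x)) :
    ∀ x ∈ l.take (durfeeSide l), durfeeSide l ≤ x := fun x hx =>
  le_of_mem_take_countP hl _ x ((List.take_subset_take_left l (durfeeSide_le_countP l)) hx)

/-- A larger entry below the square, with the entries beside the square that dominate it, would make
room for a square of side one more. -/
theorem le_durfeeSide_of_mem_belowDurfee {l : List ℕ} (hl : l.Pairwise (fun x y => y ≤ x)) :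
    ∀ x ∈ belowDurfee l, x ≤ durfeeSide l := by
  intro x hx
  by_contra hlt
  have h1 : ∀ y ∈ l.take (durfeeSide l), durfeeSide l + 1 ≤ y := by
    intro y hy
    rw [← List.take_append_drop (durfeeSide l) l, List.pairwise_append] at hl
    have := hl.2.2 y hy x hx
    omega
  have h2 : (l.take (durfeeSide l)).countP (fun x => decide (durfeeSide l + 1 ≤ x)) =
      durfeeSide l := by
    rw [List.countP_eq_length.2 (by simpa using h1), List.length_take,
      min_eq_left (durfeeSide_le_length l)]
  have h3 : 0 < (belowDurfee l).countP (fun x => decide (durfeeSide l + 1 ≤ x)) :=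
    List.countP_pos_iff.2 ⟨x, hx, by simp; omega⟩
  have h4 : durfeeSide l + 1 ≤ l.countP (fun x => decide (durfeeSide l + 1 ≤ x)) := by
    have e := List.countP_append (p := fun x => decide (durfeeSide l + 1 ≤ x))
      (l₁ := l.take (durfeeSide l)) (l₂ := l.drop (durfeeSide l))
    rw [List.take_append_drop, h2] at e
    rw [e]
    exact Nat.add_le_add_left h3 _
  have := le_durfeeSide h4
  omega

theorem durfeeSide_append {u v : List ℕ} (hu : ∀ x ∈ u, u.length ≤ x)
    (hv : ∀ x ∈ v, x ≤ u.length) : durfeeSide (u ++ v) = u.length := by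
  apply le_antisymm
  · by_contra hlt
    have h1 := durfeeSide_le_countP (u ++ v)
    rw [List.countP_append, List.countP_eq_zero (l := v) |>.2] at h1
    · have := List.countP_le_length (l := u) (p := fun x => decide (durfeeSide (u ++ v) ≤ x))
      omega
    · intro x hx
      have := hv x hx
      simp only [decide_eq_true_eq]
      omega
  · apply le_durfeeSide
    rw [List.countP_append, List.countP_eq_length.2 (by simpa using hu)]
    exact Nat.le_add_right _ _

end Lists

/-! ### Successive Durfee dissection and its generating function -/

section Dissection
open PowerSeries

/-- The side of the `k`-th successive Durfee square of `l`, with the value `L` for `k = 0`. -/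
def lastSide : ℕ → ℕ → List ℕ → ℕ
  | 0, L, _ => L
  | k + 1, _, l => lastSide k (durfeeSide l) (belowDurfee l)

theorem lastSide_succ (k L : ℕ) (l : List ℕ) :
    lastSide (k + 1) L l = durfeeSide (belowDurfee^[k] l) := by
  induction k generalizing L l with
  | zero => rfl
  | succ k ih => exact ih (durfeeSide l) (belowDurfee l)

/-- Pairs consisting of a partition with parts at most `L` that is exhausted by its first `k`
successive Durfee squares, and of an element of `Q s`, where `s` is the side of the last square. -/
def durfeePairs {Ω : Type*} (Q : ℕ → Set Ω) (k L : ℕ) : Set (List ℕ × Ω) :=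
  {x | x.1 ∈ partsIn 0 L ∧ belowDurfee^[k] x.1 = [] ∧ x.2 ∈ Q (lastSide k L x.1)}

theorem durfeeSide_le_of_mem_partsIn {L : ℕ} {l : List ℕ} (h : l ∈ partsIn 0 L) :
    durfeeSide l ≤ L := by
  rcases Nat.eq_zero_or_pos (durfeeSide l) with h0 | h0
  · omega
  · obtain ⟨x, hx, hd⟩ := List.countP_pos_iff.1 (h0.trans_le (durfeeSide_le_countP l))
    exact (of_decide_eq_true hd).trans (h.2 x hx).2

/-- A partition is glued from its Durfee square, the rows to the right of the square, and the parts
below. The latter are at most `d`, so `d` is the bound for the remaining `k` squares. -/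
theorem bijOn_durfeePairs {Ω : Type*} (Q : ℕ → Set Ω) (k : ℕ) {d L : ℕ} (h : d ≤ L) :
    Set.BijOn (fun x : List ℕ × (List ℕ × Ω) => (x.1.map (· + d) ++ x.2.1, x.2.2))
      (listBox d (L - d) ×ˢ durfeePairs Q k d)
      {x | x ∈ durfeePairs Q (k + 1) L ∧ durfeeSide x.1 = d} := by
  refine ⟨?_, ?_, ?_⟩
  · rintro ⟨u, l, ω⟩ ⟨⟨hu, hlen, hub⟩, ⟨hl, hlb⟩, hk, hω⟩
    dsimp only at hu hlen hub hl hlb hk hω ⊢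
    have hlen' : (u.map (· + d)).length = d := by simpa using hlen
    have hside : durfeeSide (u.map (· + d) ++ l) = d := by
      rw [durfeeSide_append, hlen'] <;> rw [hlen']
      · simp
      · exact fun x hx => (hlb x hx).2
    have hbelow : belowDurfee (u.map (· + d) ++ l) = l := by
      rw [belowDurfee, hside]
      exact List.drop_left' hlen'
    refine ⟨⟨⟨?_, ?_⟩, ?_, ?_⟩, hside⟩
    · refine List.pairwise_append.2 ⟨?_, hl, ?_⟩
      · rw [List.pairwise_map]
        exact hu.imp fun h => Nat.add_le_add_right h d
      · intro x hx y hy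
        obtain ⟨z, -, rfl⟩ := List.mem_map.1 hx
        exact (hlb y hy).2.trans (Nat.le_add_left _ _)
    · intro x hx
      rcases List.mem_append.1 hx with hx | hx
      · obtain ⟨z, hz, rfl⟩ := List.mem_map.1 hx
        have := hub z hz
        -- As `u` has length `d` and contains `z`, `d` is positive, so `z + d` is a genuine part
        -- even when `z = 0`.
        have := List.length_pos_of_mem hz
        omega
      · have := hlb x hx
        omega
    · rwa [Function.iterate_succ_apply, hbelow]
    · rwa [lastSide, hside, hbelow]
  · rintro ⟨u, l, ω⟩ ⟨⟨-, hlen, -⟩, -⟩ ⟨u', l', ω'⟩ ⟨⟨-, hlen', -⟩, -⟩ he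
    dsimp only at hlen hlen' he
    rw [Prod.mk.injEq] at he
    obtain ⟨he, rfl⟩ := he
    obtain ⟨h1, rfl⟩ := List.append_inj he (by simp [hlen, hlen'])
    have h2 := (List.map_injective_iff.2 (add_left_injective d)) h1
    rw [h2]
  · rintro ⟨l, ω⟩ ⟨⟨⟨hl, hlb⟩, hk, hω⟩, rfl⟩
    dsimp only at hl hlb hk hω h ⊢
    have htake := durfeeSide_le_of_mem_take hl
    refine ⟨((l.take (durfeeSide l)).map (· - durfeeSide l), (belowDurfee l, ω)),
      ⟨⟨?_, ?_, ?_⟩, ⟨?_, ?_⟩, ?_, hω⟩, ?_⟩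
    · rw [List.pairwise_map]
      exact (hl.sublist (List.take_sublist _ _)).imp fun h => Nat.sub_le_sub_right h _
    · simpa using durfeeSide_le_length l
    · intro x hx
      obtain ⟨z, hz, rfl⟩ := List.mem_map.1 hx
      exact Nat.sub_le_sub_right (hlb z (List.mem_of_mem_take hz)).2 _
    · exact hl.sublist (List.drop_sublist _ _)
    · exact fun x hx => ⟨(hlb x (List.mem_of_mem_drop hx)).1,
        le_durfeeSide_of_mem_belowDurfee hl x hx⟩
    · rwa [Function.iterate_succ_apply] at hk
    · have : ((l.take (durfeeSide l)).map (· - durfeeSide l)).map (· + durfeeSide l) =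
          l.take (durfeeSide l) := by
        rw [List.map_map]
        conv_rhs => rw [← List.map_id (l.take (durfeeSide l))]
        exact List.map_congr_left fun x hx => Nat.sub_add_cancel (htake x hx)
      simp only [this, belowDurfee, List.take_append_drop]

/-- Each square reproduces `baileyTerm M` with an extra factor `X ^ (M ^ 2)`. The bound `L` varies
because the next level is bounded by the side `d`. -/
theorem isGF_durfeePairs {Ω : Type*} {Q : ℕ → Set Ω} {w : Ω → ℕ} {M : ℕ}
    (hQ : ∀ s, IsGF (Q s) w (baileyTerm M s)) (k L : ℕ) :
    IsGF (durfeePairs Q k L) (fun x => x.1.sum + w x.2) (X ^ (k * M ^ 2) * baileyTerm M L) := by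
  induction k generalizing L with
  | zero =>
    rw [zero_mul, pow_zero, one_mul]
    refine (hQ L).image (fun ω => ([], ω)) ⟨?_, ?_, ?_⟩ (by simp)
    · exact fun ω hω => ⟨⟨List.Pairwise.nil, by simp⟩, rfl, hω⟩
    · exact fun a _ b _ h => (Prod.mk.inj h).2
    · rintro ⟨l, ω⟩ ⟨-, h, hω⟩
      dsimp only [Function.iterate_zero, id] at h
      subst h
      exact ⟨ω, hω, rfl⟩
  | succ k ih =>
    have hsum : X ^ ((k + 1) * M ^ 2) * baileyTerm M L = ∑ d ∈ Finset.range (L + 1),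
        X ^ (d ^ 2) * (qbin L d * (X ^ (k * M ^ 2) * baileyTerm M d)) := by
      rw [add_mul, one_mul, pow_add, mul_assoc, ← sum_qbin_mul_baileyTerm, Finset.mul_sum]
      exact Finset.sum_congr rfl fun d _ => by ring
    rw [hsum]
    refine IsGF.biUnion _ (A := fun d => {x | x ∈ durfeePairs Q (k + 1) L ∧ durfeeSide x.1 = d})
      ?_ ?_ ?_
    · intro d hd
      have hd' : d ≤ L := Nat.lt_succ_iff.1 (Finset.mem_range.1 hd)
      have hb := isGF_listBox d (L - d)
      rw [Nat.add_sub_cancel' hd'] at hb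
      refine (hb.prod (ih d)).image_shift (d ^ 2) _ (bijOn_durfeePairs Q k hd') ?_
      rintro ⟨u, l, ω⟩ ⟨⟨-, hlen, -⟩, -⟩
      dsimp only at hlen
      simp only [List.sum_append, List.sum_map_add, List.map_id', List.map_const', hlen,
        List.sum_replicate, smul_eq_mul]
      ring
    · intro x
      constructor
      · exact fun hx => ⟨_, Finset.mem_range.2 (Nat.lt_succ_of_le
          (durfeeSide_le_of_mem_partsIn hx.1)), hx, rfl⟩
      · rintro ⟨d, -, hx, -⟩
        exact hx
    · rintro i - j - x ⟨-, rfl⟩ ⟨-, rfl⟩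
      rfl

/-- The pairs `(β, ξ)` that are compatible with the side `s` of the last Durfee square. -/
def tailPairs (m : ℤ) (s : ℕ) : Set (List ℕ × List ℕ) :=
  {x | |m| ≤ s ∧ x.1 ∈ partsIn s (s + s) ∧ x.2 ∈ partBox (s + m).toNat (s - m).toNat}

/-- The factor `qfac (s + s)` cancels between `β` and `ξ`. What remains is symmetric in `m` and
`-m`, so only `m.natAbs` matters. -/
theorem isGF_tailPairs (m : ℤ) (s : ℕ) :
    IsGF (tailPairs m s) (fun x => x.1.sum + x.2.sum) (baileyTerm m.natAbs s) := by
  have habs := Int.abs_eq_natAbs m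
  by_cases h : |m| ≤ s
  · have h1 := (isGF_partsIn s s).prod (isGF_partBox (s + m).toNat (s - m).toNat)
    have hS : tailPairs m s = partsIn s (s + s) ×ˢ partBox (s + m).toNat (s - m).toNat := by
      ext x
      exact and_iff_right h
    rw [hS]
    convert h1 using 1
    rw [qbin_add, baileyTerm, if_pos (by omega),
      show (s + m).toNat + (s - m).toNat = s + s by omega]
    have h2 := qfac_mul_qfacInv (s + s)
    rcases le_total 0 m with hm | hm
    · rw [show (s + m).toNat = s + m.natAbs by omega, show (s - m).toNat = s - m.natAbs by omega]
      linear_combination (-qfac s * qfacInv (s - m.natAbs) * qfacInv (s + m.natAbs)) * h2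
    · rw [show (s + m).toNat = s - m.natAbs by omega, show (s - m).toNat = s + m.natAbs by omega]
      linear_combination (-qfac s * qfacInv (s - m.natAbs) * qfacInv (s + m.natAbs)) * h2
  · rw [baileyTerm, if_neg (by omega)]
    convert IsGF.empty _
    ext x
    exact iff_of_false (fun hx => h hx.1) (by simp)

end Dissection

/-! ### Passage between partitions and lists -/

namespace IntPartition

theorem coe_rows (p : IntPartition) : (p.rows : Multiset ℕ) = p.parts := Multiset.sort_eq _ _

theorem mem_rows {p : IntPartition} {x : ℕ} : x ∈ p.rows ↔ x ∈ p.parts := Multiset.mem_sort _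

theorem pairwise_rows (p : IntPartition) : p.rows.Pairwise (fun x y => y ≤ x) :=
  Multiset.pairwise_sort _ _

theorem sum_rows (p : IntPartition) : p.rows.sum = p.size := by
  rw [← Multiset.sum_coe, coe_rows]
  exact p.2.parts_sum

theorem sum_parts (p : IntPartition) : p.parts.sum = p.size := p.2.parts_sum

theorem length_rows (p : IntPartition) : p.rows.length = p.parts.card := Multiset.length_sort _

theorem pos_of_mem_rows {p : IntPartition} {x : ℕ} (h : x ∈ p.rows) : 0 < x :=
  p.2.parts_pos (mem_rows.1 h)

theorem le_size_of_mem_rows {p : IntPartition} {x : ℕ} (h : x ∈ p.rows) : x ≤ p.size :=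
  Nat.Partition.le_of_mem_parts (mem_rows.1 h)

theorem parts_injective : Function.Injective parts := by
  rintro ⟨a, p, hp, rfl⟩ ⟨b, q, hq, rfl⟩ h
  change p = q at h
  subst h
  rfl

theorem rows_injective : Function.Injective rows := fun p q h =>
  parts_injective (by rw [← coe_rows, ← coe_rows, h])

/-- The partition with a given multiset of positive parts. -/
def ofParts (s : Multiset ℕ) (h : ∀ x ∈ s, 0 < x) : IntPartition :=
  ⟨s.sum, s, fun {x} hx => h x hx, rfl⟩

theorem exists_rows_eq {l : List ℕ} (hl : l.Pairwise (fun x y => y ≤ x)) (h : ∀ x ∈ l, 0 < x) :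
    ∃ p : IntPartition, p.rows = l :=
  ⟨ofParts l h, sort_coe_of_pairwise hl⟩

end IntPartition

/-- The part of `δ` with index `j` is `k(2j+1)` plus `j + 1` or `j`, according to the sign of `m`.
The odd numbers add up to `m ^ 2` and the rest is `γ`, whose missing part for `m < 0` is the zero at
`j = 0`. -/
theorem sum_deltaParts (k : ℕ) (m : ℤ) :
    (deltaParts k m).sum = k * m.natAbs ^ 2 + (gammaParts m).sum := by
  unfold deltaParts gammaParts
  split_ifs with h
  · induction m.natAbs with
    | zero => simp
    | succ t ih =>
      rw [Multiset.range_succ, Multiset.map_cons, Multiset.sum_cons, Multiset.map_cons,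
        Multiset.sum_cons, ih]
      ring
  · obtain ⟨t, ht⟩ : ∃ t, m.natAbs = t + 1 := ⟨m.natAbs - 1, by omega⟩
    rw [ht, Nat.add_sub_cancel]
    clear ht
    induction t with
    | zero => simp
    | succ t ih =>
      rw [Multiset.range_succ, Multiset.map_cons, Multiset.sum_cons, ih, Multiset.range_succ,
        Multiset.map_cons, Multiset.sum_cons]
      ring

theorem pos_of_mem_deltaParts {k : ℕ} (hk : 1 ≤ k) {m : ℤ} {x : ℕ} (h : x ∈ deltaParts k m) :
    0 < x := by
  unfold deltaParts at h
  split_ifs at h <;> obtain ⟨j, -, rfl⟩ := Multiset.mem_map.1 h <;> omega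

theorem pos_of_mem_gammaParts {m : ℤ} {x : ℕ} (h : x ∈ gammaParts m) : 0 < x := by
  unfold gammaParts at h
  split_ifs at h <;> obtain ⟨j, -, rfl⟩ := Multiset.mem_map.1 h <;> omega

/-! ### Encoding the two sets by lists -/

theorem PairSetR.lam_injective (k : ℕ) (m : ℤ) (n : ℕ) :
    Function.Injective fun c : PairSetR k m n => c.lam.rows := by
  rintro ⟨l, d, hd, hs⟩ ⟨l', d', hd', hs'⟩ h
  obtain rfl : l = l' := IntPartition.rows_injective h
  obtain rfl := IntPartition.parts_injective (hd.trans hd'.symm)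
  rfl

theorem PairSetR.exists_rows_eq_iff {k : ℕ} (hk : 1 ≤ k) (m : ℤ) {n L : ℕ} (hL : n ≤ L)
    (l : List ℕ) : (∃ c : PairSetR k m n, c.lam.rows = l) ↔
      l ∈ partsIn 0 L ∧ l.sum + (deltaParts k m).sum = n := by
  constructor
  · rintro ⟨⟨l, d, hd, hs⟩, rfl⟩
    refine ⟨⟨l.pairwise_rows, fun x hx => ⟨IntPartition.pos_of_mem_rows hx, ?_⟩⟩, ?_⟩
    · exact (IntPartition.le_size_of_mem_rows hx).trans (by dsimp only; omega)
    · rw [← hd, IntPartition.sum_parts, IntPartition.sum_rows, hs]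
  · rintro ⟨⟨hl, hp⟩, hs⟩
    obtain ⟨p, rfl⟩ := IntPartition.exists_rows_eq hl fun x hx => (hp x hx).1
    rw [IntPartition.sum_rows] at hs
    exact ⟨⟨p, .ofParts (deltaParts k m) fun _ hx => pos_of_mem_deltaParts hk hx, rfl, hs⟩, rfl⟩

theorem TupleSetS.rows_injective (k : ℕ) (hk : 1 ≤ k) (m : ℤ) (n : ℕ) :
    Function.Injective fun c : TupleSetS k hk m n => (c.alpha.rows, c.beta.rows, c.xi.rows) := by
  rintro ⟨s, a, b, c, x, _, _, ha, _, _, hc, _, _, _, _⟩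
    ⟨s', a', b', c', x', _, _, ha', _, _, hc', _, _, _, _⟩ h
  simp only [Prod.mk.injEq] at h
  obtain ⟨h1, h2, h3⟩ := h
  obtain rfl := IntPartition.rows_injective h1
  obtain rfl := IntPartition.rows_injective h2
  obtain rfl := IntPartition.rows_injective h3
  obtain rfl := IntPartition.parts_injective (hc.trans hc'.symm)
  obtain rfl : s = s' := funext fun i => (ha i).symm.trans (ha' i)
  rfl

theorem durfeeSide_belowDurfee_le {l : List ℕ} (hl : l.Pairwise (fun x y => y ≤ x)) :
    durfeeSide (belowDurfee l) ≤ durfeeSide l := by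
  rcases Nat.eq_zero_or_pos (durfeeSide (belowDurfee l)) with h0 | h0
  · omega
  · obtain ⟨x, hx, hd⟩ := List.countP_pos_iff.1 (h0.trans_le (durfeeSide_le_countP _))
    exact (of_decide_eq_true hd).trans (le_durfeeSide_of_mem_belowDurfee hl x hx)

theorem pairwise_iterate_belowDurfee {l : List ℕ} (hl : l.Pairwise (fun x y => y ≤ x)) (i : ℕ) :
    (belowDurfee^[i] l).Pairwise (fun x y => y ≤ x) := by
  induction i with
  | zero => exact hl
  | succ i ih =>
    rw [Function.iterate_succ_apply']
    exact ih.sublist (List.drop_sublist _ _)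

theorem antitone_durfeeSide_iterate {l : List ℕ} (hl : l.Pairwise (fun x y => y ≤ x)) :
    Antitone fun i => durfeeSide (belowDurfee^[i] l) := by
  refine antitone_nat_of_succ_le fun i => ?_
  rw [Function.iterate_succ_apply']
  exact durfeeSide_belowDurfee_le (pairwise_iterate_belowDurfee hl i)

/-- The lower bound `s_k` on the parts of `α` is automatic: every part lies beside one of the
squares, whose sides decrease. -/
theorem durfeeSide_iterate_le_of_mem {k : ℕ} {l : List ℕ} (hl : l.Pairwise (fun x y => y ≤ x))
    (hk : belowDurfee^[k + 1] l = []) : ∀ x ∈ l, durfeeSide (belowDurfee^[k] l) ≤ x := by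
  induction k generalizing l with
  | zero =>
    intro x hx
    rw [← List.take_append_drop (durfeeSide l) l] at hx
    rcases List.mem_append.1 hx with hx | hx
    · exact durfeeSide_le_of_mem_take hl x hx
    · rw [show l.drop (durfeeSide l) = [] from hk] at hx
      simp at hx
  | succ k ih =>
    intro x hx
    rw [← List.take_append_drop (durfeeSide l) l] at hx
    rcases List.mem_append.1 hx with hx | hx
    · exact (antitone_durfeeSide_iterate hl (Nat.zero_le (k + 1))).trans
        (durfeeSide_le_of_mem_take hl x hx)
    · exact ih (hl.sublist (List.drop_sublist _ _)) hk x hx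

theorem TupleSetS.exists_rows_eq_iff {k : ℕ} (hk : 1 ≤ k) (m : ℤ) {n L : ℕ} (hL : n ≤ L)
    (x : List ℕ × (List ℕ × List ℕ)) :
    (∃ c : TupleSetS k hk m n, (c.alpha.rows, c.beta.rows, c.xi.rows) = x) ↔
      x ∈ durfeePairs (tailPairs m) k L ∧
        x.1.sum + (x.2.1.sum + x.2.2.sum) + (gammaParts m).sum = n := by
  obtain ⟨k, rfl⟩ : ∃ j, k = j + 1 := ⟨k - 1, by omega⟩
  constructor
  · rintro ⟨⟨s, a, b, c, ξ, -, -, ha, hend, hb, hc, hm, hx, hx', hs⟩, rfl⟩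
    have hlast : lastEntry hk s = lastSide (k + 1) L a.rows := by
      rw [lastSide_succ]
      exact (ha ⟨k, Nat.lt_succ_self k⟩).symm
    rw [hlast] at hb hm hx hx'
    refine ⟨⟨⟨a.pairwise_rows, fun x hx => ⟨IntPartition.pos_of_mem_rows hx, ?_⟩⟩, hend, hm,
      ⟨b.pairwise_rows, ?_⟩, ξ.pairwise_rows, ?_, ?_⟩, ?_⟩
    · exact (IntPartition.le_size_of_mem_rows hx).trans (by dsimp only; omega)
    · intro x hx
      have := hb x (IntPartition.mem_rows.1 hx)
      dsimp only at this ⊢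
      omega
    · rw [IntPartition.length_rows]
      dsimp only at hx ⊢
      omega
    · intro x hx
      have h1 := hx' x (IntPartition.mem_rows.1 hx)
      have h2 := IntPartition.pos_of_mem_rows hx
      dsimp only at h1 h2 ⊢
      omega
    · rw [← hc, IntPartition.sum_parts]
      simp only [IntPartition.sum_rows]
      omega
  · obtain ⟨l, b, ξ⟩ := x
    rintro ⟨⟨⟨hl, hlp⟩, hend, hm, ⟨hb, hbp⟩, hξ, hξc, hξp⟩, hs⟩
    dsimp only at hl hlp hend hm hb hbp hξ hξc hξp hs
    obtain ⟨p, rfl⟩ := IntPartition.exists_rows_eq hl fun x hx => (hlp x hx).1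
    obtain ⟨q, rfl⟩ := IntPartition.exists_rows_eq hb fun x hx => Nat.zero_lt_of_lt (hbp x hx).1
    obtain ⟨r, rfl⟩ := IntPartition.exists_rows_eq hξ fun x hx => (hξp x hx).1
    rw [lastSide_succ] at hm hbp hξc hξp
    have hlast : lastEntry hk (fun i : Fin (k + 1) => p.succDurfee i) =
      durfeeSide (belowDurfee^[k] p.rows) := rfl
    refine ⟨⟨fun i => p.succDurfee i, p, q, .ofParts (gammaParts m) fun x hx =>
      pos_of_mem_gammaParts hx, r, ?_, ?_, fun i => rfl, hend, ?_, rfl, hm, ?_, ?_, ?_⟩, rfl⟩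
    · exact fun i j hij => antitone_durfeeSide_iterate hl hij
    · exact fun x hx => durfeeSide_iterate_le_of_mem hl hend x (IntPartition.mem_rows.2 hx)
    · intro x hx
      have := hbp x (IntPartition.mem_rows.2 hx)
      rw [hlast]
      omega
    · rw [hlast, ← IntPartition.length_rows]
      -- With `|m| ≤ s_k` this makes `s_k + m` nonnegative, so `Int.toNat` does not truncate.
      have := neg_abs_le m
      omega
    · intro x hx
      have h1 := (hξp x (IntPartition.mem_rows.2 hx)).2
      have := le_abs_self m
      rw [hlast]
      omega
    · rw [IntPartition.sum_rows, IntPartition.sum_rows, IntPartition.sum_rows] at hs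
      have : (IntPartition.ofParts (gammaParts m) fun x hx => pos_of_mem_gammaParts hx).size =
        (gammaParts m).sum := rfl
      omega

/-! ### Comparison of coefficients -/

open PowerSeries in
theorem theorem1p4 (k : ℕ) (hk : 1 ≤ k) (m : ℤ) (n : ℕ) (hn : 1 ≤ n) :
    ∃ χ : PairSetR k m n → TupleSetS k hk m n, Function.Bijective χ := by
  -- The bound `n + m.natAbs` leaves the parts unrestricted at weight `n` and is the index at which
  -- `coeff_baileyTerm` applies.
  have hL : n ≤ n + m.natAbs := Nat.le_add_right _ _
  have h1 := (isGF_partsIn 0 (n + m.natAbs)).shift (deltaParts k m).sum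
  rw [zero_add, qfac_zero, one_mul] at h1
  have h2 := (isGF_durfeePairs (isGF_tailPairs m) k (n + m.natAbs)).shift (gammaParts m).sum
  refine h1.exists_bijective h2 (n := n) ?_ _ (PairSetR.lam_injective k m n)
    (PairSetR.exists_rows_eq_iff hk m hL) _ (TupleSetS.rows_injective k hk m n)
    (TupleSetS.exists_rows_eq_iff hk m hL)
  rw [← mul_assoc, ← pow_add, sum_deltaParts, add_comm (_ * _),
    coeff_X_pow_mul', coeff_X_pow_mul']
  split_ifs with h
  · exact (coeff_baileyTerm n m.natAbs _ (Nat.sub_le _ _)).symm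
  · rfl
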